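/- Let $k\subseteq K$ be a finite field extension. All (co)algebras are (co)associative and (co)unital (not necessarily (co)commutative), as are their morphisms, and $(-)_K=K\otimes_k-$ denotes scalar extension, turning $k$-vector spaces, $k$-algebras, $k$-coalgebras, $k$-bialgebras and Hopf $k$-algebras, and the morphisms between them, into the corresponding structures over $K$. For a field $F$: - a *cofree coalgebra* on an $F$-vector space $V$ is an $F$-coalgebra $C$ with an $F$-linear map $\pi:C\to V$ such that every linear map $D\to V$ from an $F$-coalgebra $D$ factors through $\pi$ via a unique coalgebra morphism $D\to C$; - a *cofree bialgebra* on an $F$-algebra $A$ is an $F$-bialgebra $B$ with an algebra morphism $\pi:B\to A$ such that every algebra morphism $D\to A$ from an $F$-bialgebra $D$ factors through $\pi$ via a unique bialgebra morphism $D\to B$; - a *cofree Hopf algebra* on an $F$-bialgebra $B$ is a Hopf $F$-algebra $H$ with a bialgebra morphism $\pi:H\to B$ such that every bialgebra morphism $D\to B$ from a Hopf $F$-algebra $D$ factors through $\pi$ via a unique Hopf algebra morphism $D\to H$; - a *cofree Hopf algebra* on an $F$-algebra $A$ is a Hopf $F$-algebra $H$ with an algebra morphism $\pi:H\to A$ such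 that every algebra morphism $D\to A$ from a Hopf $F$-algebra $D$ factors through $\pi$ via a unique Hopf algebra morphism $D\to H$. (That is, they are the values, with their structure maps, of the right adjoints to the forgetful functors from coalgebras to vector spaces, from bialgebras to algebras, from Hopf algebras to bialgebras, and from Hopf algebras to algebras.) Then scalar extension along $k\subseteq K$ preserves all four constructions: 1. if $\pi:C\to V$ is a cofree coalgebra on the $k$-vector space $V$, then $\pi_K:C_K\to V_K$ is a cofree coalgebra on the $K$-vector space $V_K$; 2. if $\pi:B\to A$ is a cofree bialgebra on the $k$-algebra $A$, then $\pi_K:B_K\to A_K$ is a cofree bialgebra on the $K$-algebra $A_K$; 3. if $\pi:H\to B$ is a cofree Hopf algebra on the $k$-bialgebra $B$, then $\pi_K:H_K\to B_K$ is a cofree Hopf algebra on the $K$-bialgebra $B_K$; 4. if $\pi:H\to A$ is a cofree Hopf algebra on the $k$-algebra $A$, then $\pi_K:H_K\to A_K$ is a cofree Hopf algebra on the $K$-algebra $A_K$. -/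

import Mathlib

open scoped TensorProduct

universe u v w

/-- `π : C → V` exhibits the coalgebra `C` as the cofree `k`-coalgebra on the vector space `V`, i.e.
as the value at `V` (with its counit) of the right adjoint of the forgetful functor from
`k`-coalgebras to `k`-vector spaces: every linear map from a coalgebra `D` to `V` factors through
`π` by a unique coalgebra morphism `D → C`. -/
def IsCofreeCoalgebra (k : Type u) [Field k] {C V : Type w}
    [AddCommGroup C] [Module k C] [Coalgebra k C] [AddCommGroup V] [Module k V]
    (π : C →ₗ[k] V) : Prop :=
  ∀ (D : Type w) [AddCommGroup D] [Module k D] [Coalgebra k D] (f : D →ₗ[k] V),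
    ∃! g : D →ₗc[k] C, π ∘ₗ (g : D →ₗ[k] C) = f

/-- `π : B → A` exhibits the bialgebra `B` as the cofree `k`-bialgebra on the algebra `A`: every
algebra morphism from a bialgebra `D` to `A` factors through `π` by a unique bialgebra morphism
`D → B`. -/
def IsCofreeBialgebra (k : Type u) [Field k] {B A : Type w}
    [Ring B] [Bialgebra k B] [Ring A] [Algebra k A]
    (π : B →ₐ[k] A) : Prop :=
  ∀ (D : Type w) [Ring D] [Bialgebra k D] (f : D →ₐ[k] A),
    ∃! g : D →ₐc[k] B, π.comp (g : D →ₐ[k] B) = f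

/-- `π : H → B` exhibits the Hopf algebra `H` as the cofree Hopf `k`-algebra on the bialgebra `B`:
every bialgebra morphism from a Hopf algebra `D` to `B` factors through `π` by a unique morphism
`D → H` of Hopf algebras (a bialgebra morphism between Hopf algebras; it automatically respects
antipodes). -/
def IsCofreeHopfOnBialgebra (k : Type u) [Field k] {H B : Type w}
    [Ring H] [HopfAlgebra k H] [Ring B] [Bialgebra k B]
    (π : H →ₐc[k] B) : Prop :=
  ∀ (D : Type w) [Ring D] [HopfAlgebra k D] (f : D →ₐc[k] B),
    ∃! g : D →ₐc[k] H, π.comp g = f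

/-- `π : H → A` exhibits the Hopf algebra `H` as the cofree Hopf `k`-algebra on the algebra `A`:
every algebra morphism from a Hopf algebra `D` to `A` factors through `π` by a unique morphism
`D → H` of Hopf algebras. -/
def IsCofreeHopfOnAlgebra (k : Type u) [Field k] {H A : Type w}
    [Ring H] [HopfAlgebra k H] [Ring A] [Algebra k A]
    (π : H →ₐ[k] A) : Prop :=
  ∀ (D : Type w) [Ring D] [HopfAlgebra k D] (f : D →ₐ[k] A),
    ∃! g : D →ₐc[k] H, π.comp (g : D →ₐ[k] H) = f

/-! A finite extension K of k is a Frobenius k-algebra, so restriction of scalars is left adjoint,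
not only right adjoint, to base change on vector spaces. With dual families l_i, r_i for a form, the
unit of this adjunction is m ↦ ∑ l_i ⊗ r_i m (`FrobeniusSystem.unit`), and transposition composes
with the form (`FrobeniusSystem.lift`).

Base change is monoidal, so its left adjoint carries coalgebras to coalgebras: a K-coalgebra D
becomes a k-coalgebra whose operations are the transposes of those of D. On algebras, base change
also has a left adjoint, a quotient of the tensor algebra of D (`RestrictAlgebra`), which inherits
comultiplication, counit and antipode from D by the same transposition.

Thus in all four cases base change has a left adjoint L that commutes with the forgetful functor in
question. A map D → V_K is then the same as a map L D → V, which factors uniquely through π by a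
morphism L D → C, that is, by a morphism D → C_K. -/

open TensorProduct

/-! ### Frobenius duality: restriction of scalars as left adjoint of base change -/

/-- A Frobenius system for `K` over `k`: a linear form together with a pair of dual families. -/
structure FrobeniusSystem (k K : Type*) [Field k] [Field K] [Algebra k K] (ι : Type*)
    [Fintype ι] where
  form : K →ₗ[k] k
  left : ι → K
  right : ι → K
  sum_form_mul_left : ∀ x, ∑ i, form (x * left i) • right i = x
  sum_form_mul_right : ∀ x, ∑ i, form (x * right i) • left i = x

/-- Any form φ with φ(1) ≠ 0 works: (x, y) ↦ φ(xy) is nondegenerate because a nonzero x pairs with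
x⁻¹ to φ(1). No separability is needed, as φ need not be the trace. A basis and its dual basis give
the two families. -/
theorem FrobeniusSystem.nonempty (k K : Type*) [Field k] [Field K] [Algebra k K]
    [FiniteDimensional k K] :
    Nonempty (FrobeniusSystem k K (Fin (Module.finrank k K))) := by
  obtain ⟨φ, hφ⟩ : ∃ φ : Module.Dual k K, φ 1 ≠ 0 := by
    by_contra! h
    exact one_ne_zero ((Module.forall_dual_apply_eq_zero_iff k (1 : K)).1 h)
  let B : LinearMap.BilinForm k K := (LinearMap.mul k K).compr₂ φ
  have hsymm : B.IsSymm := ⟨fun x y => by simp [B, mul_comm]⟩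
  have hsep : ∀ x, (∀ y, B x y = 0) → x = 0 := fun x hx => by
    by_contra hx0
    exact hφ (by simpa [B, hx0] using hx x⁻¹)
  have hB : B.Nondegenerate :=
    ⟨hsep, fun y hy => hsep y fun x => by simpa [B, mul_comm] using hy x⟩
  let b := Module.finBasis k K
  refine ⟨⟨φ, b, B.dualBasis hB b, fun x => ?_, fun x => ?_⟩⟩
  · conv_rhs => rw [← (B.dualBasis hB b).sum_repr x]
    simp [LinearMap.BilinForm.dualBasis_repr_apply, B]
  · conv_rhs => rw [← b.sum_repr x]
    refine Finset.sum_congr rfl fun i _ => ?_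
    -- The pairing is symmetric, so `b` is in turn dual to its dual basis and its coordinates are
    -- again values of the form.
    conv_rhs => rw [← LinearMap.BilinForm.dualBasis_dualBasis hB hsymm b,
      LinearMap.BilinForm.dualBasis_repr_apply]
    simp [B, LinearMap.BilinForm.dualBasis_dualBasis hB hsymm b]

/-- Contraction of the left tensor factor with a linear form. -/
noncomputable def sliceLeft {k K : Type*} [Field k] [Field K] [Algebra k K] (V : Type*)
    [AddCommGroup V] [Module k V] (φ : K →ₗ[k] k) : K ⊗[k] V →ₗ[k] V :=
  (TensorProduct.lid k V).toLinearMap ∘ₗ φ.rTensor V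

section
variable {k K : Type*} [Field k] [Field K] [Algebra k K]
variable {V W : Type*} [AddCommGroup V] [Module k V] [AddCommGroup W] [Module k W]

@[simp]
theorem sliceLeft_tmul (φ : K →ₗ[k] k) (a : K) (v : V) :
    sliceLeft V φ (a ⊗ₜ v) = φ a • v := by
  simp [sliceLeft]

theorem sliceLeft_baseChange (φ : K →ₗ[k] k) (g : V →ₗ[k] W) (t : K ⊗[k] V) :
    sliceLeft W φ (g.baseChange K t) = g (sliceLeft V φ t) := by
  induction t with
  | zero => simp
  | add x y hx hy => simp only [map_add, hx, hy]
  | tmul a v => simp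

end

namespace FrobeniusSystem

variable {k K : Type*} [Field k] [Field K] [Algebra k K] {ι : Type*} [Fintype ι]
variable (F : FrobeniusSystem k K ι)
variable {V W : Type*} [AddCommGroup V] [Module k V] [AddCommGroup W] [Module k W]

theorem sum_tmul_sliceLeft (t : K ⊗[k] V) :
    ∑ i, F.left i ⊗ₜ[k] sliceLeft V F.form (F.right i • t) = t := by
  induction t with
  | zero => simp
  | add x y hx hy => simp only [smul_add, map_add, tmul_add, Finset.sum_add_distrib, hx, hy]
  | tmul a v =>
    conv_rhs => rw [← F.sum_form_mul_right a]
    simp [smul_tmul', sum_tmul, mul_comm]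

-- The coefficients in the preceding expansion are themselves slices, along the forms x ↦ form(r_i
-- x). An equation in K ⊗ V thereby amounts to a family of equations in V.
include F in
theorem eq_of_sliceLeft_eq {s t : K ⊗[k] V}
    (h : ∀ φ : K →ₗ[k] k, sliceLeft V φ s = sliceLeft V φ t) : s = t := by
  have key (a : K) (t : K ⊗[k] V) : sliceLeft V F.form (a • t) =
      sliceLeft V (F.form ∘ₗ LinearMap.mulLeft k a) t := by
    induction t with
    | zero => simp
    | add x y hx hy => simp only [smul_add, map_add, hx, hy]
    | tmul b v => simp [smul_tmul']
  rw [← F.sum_tmul_sliceLeft s, ← F.sum_tmul_sliceLeft t]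
  simp only [key, h]

variable (M : Type*) [AddCommGroup M] [Module k M] [Module K M] [IsScalarTower k K M]

/-- Centrality of the Casimir element: expanded in the dual families, both sides have the
coefficients form(a l_i r_j). This is what makes the unit K-linear. -/
theorem sum_mul_left_tmul_right (a : K) :
    ∑ i, (a * F.left i) ⊗ₜ[k] F.right i = ∑ i, F.left i ⊗ₜ[k] (F.right i * a) := by
  have h1 (i : ι) : (a * F.left i) ⊗ₜ[k] F.right i =
      ∑ j, F.left j ⊗ₜ[k] (F.form (a * F.left i * F.right j) • F.right i) := by
    conv_lhs => rw [← F.sum_form_mul_right (a * F.left i)]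
    simp only [sum_tmul, smul_tmul]
  have h2 (j : ι) : F.left j ⊗ₜ[k] (F.right j * a) =
      ∑ i, F.left j ⊗ₜ[k] (F.form (a * F.left i * F.right j) • F.right i) := by
    conv_lhs => rw [← F.sum_form_mul_left (F.right j * a)]
    simp only [tmul_sum]
    exact Finset.sum_congr rfl fun i _ => by rw [mul_comm (F.right j), mul_right_comm]
  simp only [h1, h2]
  exact Finset.sum_comm

/-- The unit `M → K ⊗ M` exhibiting restriction of scalars as left adjoint to base change. -/
noncomputable def unit : M →ₗ[K] K ⊗[k] M where
  toFun m := ∑ i, F.left i ⊗ₜ (F.right i • m)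
  map_add' x y := by simp [tmul_add, Finset.sum_add_distrib]
  map_smul' a m := by
    have := congrArg
      (LinearMap.lTensor K ((LinearMap.toSpanSingleton K M m).restrictScalars k))
      (F.sum_mul_left_tmul_right a)
    simpa [Finset.smul_sum, smul_tmul', mul_smul] using this.symm

variable {M}

theorem unit_apply (m : M) : F.unit M m = ∑ i, F.left i ⊗ₜ (F.right i • m) := rfl

theorem sliceLeft_unit (m : M) : sliceLeft M F.form (F.unit M m) = m := by
  have := congrArg (· • m) (F.sum_form_mul_left 1)
  simpa [unit_apply, Finset.sum_smul] using this

/-- The `k`-linear map corresponding to a `K`-linear map into a base change. -/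
noncomputable def lift (f : M →ₗ[K] K ⊗[k] V) : M →ₗ[k] V :=
  sliceLeft V F.form ∘ₗ f.restrictScalars k

/-- Existence half of the adjunction. By K-linearity of `f` the left side is the expansion of f(m)
by slices; `hom_ext` below is the uniqueness half. -/
theorem baseChange_lift_unit (f : M →ₗ[K] K ⊗[k] V) (m : M) :
    (F.lift f).baseChange K (F.unit M m) = f m := by
  simp [unit_apply, lift, F.sum_tmul_sliceLeft]

theorem hom_ext {g h : M →ₗ[k] V}
    (H : ∀ m, g.baseChange K (F.unit M m) = h.baseChange K (F.unit M m)) : g = h := by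
  ext m
  have := congrArg (sliceLeft V F.form) (H m)
  simpa only [sliceLeft_baseChange, sliceLeft_unit] using this

end FrobeniusSystem

/-! ### Base change as a monoidal functor -/

section DistribBaseChange

variable (k K : Type*) [Field k] [Field K] [Algebra k K]
variable {L M N P : Type*} [AddCommGroup L] [Module k L] [AddCommGroup M] [Module k M]
  [AddCommGroup N] [Module k N] [AddCommGroup P] [Module k P]

open AlgebraTensorModule (distribBaseChange)

theorem distribBaseChange_baseChange_map (f : L →ₗ[k] N) (g : M →ₗ[k] P)
    (t : K ⊗[k] (L ⊗[k] M)) :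
    distribBaseChange k K N P ((TensorProduct.map f g).baseChange K t) =
      TensorProduct.map (f.baseChange K) (g.baseChange K) (distribBaseChange k K L M t) := by
  have : (distribBaseChange k K N P).toLinearMap ∘ₗ (TensorProduct.map f g).baseChange K =
      TensorProduct.map (f.baseChange K) (g.baseChange K) ∘ₗ
        (distribBaseChange k K L M).toLinearMap := by
    ext; simp
  exact LinearMap.congr_fun this t

theorem distribBaseChange_assoc (t : K ⊗[k] ((L ⊗[k] M) ⊗[k] N)) :
    (distribBaseChange k K M N).toLinearMap.lTensor _ (distribBaseChange k K L (M ⊗[k] N)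
        ((TensorProduct.assoc k L M N).toLinearMap.baseChange K t)) =
      TensorProduct.assoc K _ _ _ ((distribBaseChange k K L M).toLinearMap.rTensor _
        (distribBaseChange k K (L ⊗[k] M) N t)) := by
  have : (distribBaseChange k K M N).toLinearMap.lTensor _ ∘ₗ
      (distribBaseChange k K L (M ⊗[k] N)).toLinearMap ∘ₗ
        ((TensorProduct.assoc k L M N).toLinearMap.baseChange K) =
      (TensorProduct.assoc K _ _ _).toLinearMap ∘ₗ
        (distribBaseChange k K L M).toLinearMap.rTensor _ ∘ₗ
        (distribBaseChange k K (L ⊗[k] M) N).toLinearMap := by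
    ext; simp
  exact LinearMap.congr_fun this t

theorem rTensor_rid_distribBaseChange_mk_one (t : K ⊗[k] L) :
    (AlgebraTensorModule.rid k K K).toLinearMap.rTensor _ (distribBaseChange k K k L
      ((TensorProduct.mk k k L 1).baseChange K t)) = 1 ⊗ₜ[K] t := by
  induction t with
  | zero => simp
  | add x y hx hy => simp only [map_add, tmul_add, hx, hy]
  | tmul a x =>
    rw [tmul_eq_smul_one_tmul a x, ← smul_tmul]
    simp [smul_tmul']

theorem lTensor_rid_distribBaseChange_mk_one (t : K ⊗[k] L) :
    (AlgebraTensorModule.rid k K K).toLinearMap.lTensor _ (distribBaseChange k K L k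
      (((TensorProduct.mk k L k).flip 1).baseChange K t)) = t ⊗ₜ[K] 1 := by
  induction t with
  | zero => simp
  | add x y hx hy => simp only [map_add, add_tmul, hx, hy]
  | tmul a x => simp

variable {C : Type*} [AddCommGroup C] [Module k C] [Coalgebra k C]

theorem comul_baseChange (t : K ⊗[k] C) :
    Coalgebra.comul (R := K) t =
      distribBaseChange k K C C ((Coalgebra.comul (R := k) (A := C)).baseChange K t) := by
  -- The coalgebra K over itself has Δ(a) = 1 ⊗ a, so the scalar sits in the second factor and must
  -- be moved across the tensor product over K.
  have aux (a : K) (s : C ⊗[k] C) : AlgebraTensorModule.tensorTensorTensorComm k K k K K K C C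
      ((1 ⊗ₜ[K] a) ⊗ₜ[k] s) = distribBaseChange k K C C (a ⊗ₜ s) := by
    induction s with
    | zero => simp
    | add x y hx hy => simp only [map_add, tmul_add, hx, hy]
    | tmul x y =>
      rw [← mul_one a, ← smul_eq_mul, ← smul_tmul]
      simp
  induction t with
  | zero => simp
  | add x y hx hy => simp only [map_add, hx, hy]
  | tmul a x => simp [aux]

theorem counit_baseChange (t : K ⊗[k] C) :
    Coalgebra.counit (R := K) t = AlgebraTensorModule.rid k K K
      ((Coalgebra.counit (R := k) (A := C)).baseChange K t) := by
  induction t with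
  | zero => simp
  | add x y hx hy => simp only [map_add, hx, hy]
  | tmul a x => simp

end DistribBaseChange

/-! ### Transfer of coalgebra axioms along a compatible map -/

section Compatible

variable {k K : Type*} [Field k] [Field K] [Algebra k K]
variable {D L : Type*} [AddCommGroup D] [Module K D] [Coalgebra K D]
  [AddCommGroup L] [Module k L]

open AlgebraTensorModule (distribBaseChange)
open Coalgebra (comul counit)

/-- A `K`-linear map from a `K`-coalgebra to the base change of a `k`-module with a candidate
coalgebra structure respects comultiplication and counit. -/
structure IsCompatible [CoalgebraStruct k L] (η : D →ₗ[K] K ⊗[k] L) : Prop where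
  map_comul (d : D) : distribBaseChange k K L L ((comul (R := k) (A := L)).baseChange K (η d)) =
    TensorProduct.map η η (Coalgebra.comul d)
  map_counit (d : D) : AlgebraTensorModule.rid k K K
    ((counit (R := k) (A := L)).baseChange K (η d)) = Coalgebra.counit d

namespace IsCompatible

section
variable [CoalgebraStruct k L] {η : D →ₗ[K] K ⊗[k] L} (h : IsCompatible η)
include h

/-- Once base change is distributed over the tensor products, both sides become η ⊗ η ⊗ η applied to
the iterated coproduct of `d`, so coassociativity of `D` decides. Only the operations of `L` are
assumed: this identity and the two counit identities serve to prove its axioms when η is universal.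
-/
theorem coassoc (d : D) :
    ((TensorProduct.assoc k L L L).toLinearMap ∘ₗ (comul (R := k) (A := L)).rTensor L ∘ₗ
      comul).baseChange K (η d) =
    ((comul (R := k) (A := L)).lTensor L ∘ₗ comul).baseChange K (η d) := by
  apply (distribBaseChange k K L (L ⊗[k] L)).injective
  apply ((distribBaseChange k K L L).lTensor (K ⊗[k] L)).injective
  have hr (z : D ⊗[K] D) : (distribBaseChange k K L L).toLinearMap.rTensor (K ⊗[k] L)
      (((comul (R := k) (A := L)).baseChange K).rTensor _ (TensorProduct.map η η z)) =
      TensorProduct.map (TensorProduct.map η η) η ((comul (R := K)).rTensor D z) := by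
    induction z with
    | zero => simp
    | add x y hx hy => simp only [map_add, hx, hy]
    | tmul x y => simp [h.map_comul]
  have hl (z : D ⊗[K] D) : (distribBaseChange k K L L).toLinearMap.lTensor (K ⊗[k] L)
      (((comul (R := k) (A := L)).baseChange K).lTensor _ (TensorProduct.map η η z)) =
      TensorProduct.map η (TensorProduct.map η η) ((comul (R := K)).lTensor D z) := by
    induction z with
    | zero => simp
    | add x y hx hy => simp only [map_add, hx, hy]
    | tmul x y => simp [h.map_comul]
  have ha (z : (D ⊗[K] D) ⊗[K] D) : TensorProduct.assoc K _ _ _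
      (TensorProduct.map (TensorProduct.map η η) η z) =
      TensorProduct.map η (TensorProduct.map η η) (TensorProduct.assoc K _ _ _ z) := by
    have : (TensorProduct.assoc K _ _ _).toLinearMap ∘ₗ
        TensorProduct.map (TensorProduct.map η η) η =
        TensorProduct.map η (TensorProduct.map η η) ∘ₗ
          (TensorProduct.assoc K _ _ _).toLinearMap := by ext; simp
    exact LinearMap.congr_fun this z
  -- `e1` moves the associator past base change; `e2` and `e3` do so for Δ ⊗ id and id ⊗ Δ.
  have e1 := distribBaseChange_assoc k K (L := L) (M := L) (N := L)
    (((comul (R := k) (A := L)).rTensor L).baseChange K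
      ((comul (R := k) (A := L)).baseChange K (η d)))
  have e2 := distribBaseChange_baseChange_map k K (comul (R := k) (A := L)) (.id (M := L))
    ((comul (R := k) (A := L)).baseChange K (η d))
  have e3 := distribBaseChange_baseChange_map k K (.id (M := L)) (comul (R := k) (A := L))
    ((comul (R := k) (A := L)).baseChange K (η d))
  rw [h.map_comul, LinearMap.baseChange_id] at e2 e3
  simp only [LinearMap.baseChange_comp, LinearMap.comp_apply]
  refine (e1.trans ?_).trans (congrArg _ e3.symm)
  refine (congrArg (fun z => TensorProduct.assoc K _ _ _
    ((distribBaseChange k K L L).toLinearMap.rTensor _ z)) e2).trans ?_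
  refine (congrArg (TensorProduct.assoc K _ _ _) (hr _)).trans ?_
  refine (ha _).trans ?_
  rw [Coalgebra.coassoc_apply]
  exact (hl _).symm

theorem rTensor_counit (d : D) :
    ((counit (R := k) (A := L)).rTensor L ∘ₗ comul).baseChange K (η d) =
      (TensorProduct.mk k k L 1).baseChange K (η d) := by
  apply (distribBaseChange k K k L).injective
  apply ((AlgebraTensorModule.rid k K K).rTensor (K ⊗[k] L)).injective
  have hr (z : D ⊗[K] D) : (AlgebraTensorModule.rid k K K).toLinearMap.rTensor (K ⊗[k] L)
      (((counit (R := k) (A := L)).baseChange K).rTensor _ (TensorProduct.map η η z)) =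
      TensorProduct.map .id η ((counit (R := K)).rTensor D z) := by
    induction z with
    | zero => simp
    | add x y hx hy => simp only [map_add, hx, hy]
    | tmul x y => simp [h.map_counit]
  have e2 := distribBaseChange_baseChange_map k K (counit (R := k) (A := L)) (.id (M := L))
    ((comul (R := k) (A := L)).baseChange K (η d))
  rw [h.map_comul, LinearMap.baseChange_id] at e2
  simp only [LinearMap.baseChange_comp, LinearMap.comp_apply]
  refine (congrArg ((AlgebraTensorModule.rid k K K).toLinearMap.rTensor _) e2).trans ?_
  refine (hr _).trans ?_
  rw [Coalgebra.rTensor_counit_comul]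
  exact (rTensor_rid_distribBaseChange_mk_one k K (η d)).symm

theorem lTensor_counit (d : D) :
    ((counit (R := k) (A := L)).lTensor L ∘ₗ comul).baseChange K (η d) =
      ((TensorProduct.mk k L k).flip 1).baseChange K (η d) := by
  apply (distribBaseChange k K L k).injective
  apply ((AlgebraTensorModule.rid k K K).lTensor (K ⊗[k] L)).injective
  have hr (z : D ⊗[K] D) : (AlgebraTensorModule.rid k K K).toLinearMap.lTensor (K ⊗[k] L)
      (((counit (R := k) (A := L)).baseChange K).lTensor _ (TensorProduct.map η η z)) =
      TensorProduct.map η .id ((counit (R := K)).lTensor D z) := by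
    induction z with
    | zero => simp
    | add x y hx hy => simp only [map_add, hx, hy]
    | tmul x y => simp [h.map_counit]
  have e2 := distribBaseChange_baseChange_map k K (.id (M := L)) (counit (R := k) (A := L))
    ((comul (R := k) (A := L)).baseChange K (η d))
  rw [h.map_comul, LinearMap.baseChange_id] at e2
  simp only [LinearMap.baseChange_comp, LinearMap.comp_apply]
  refine (congrArg ((AlgebraTensorModule.rid k K K).toLinearMap.lTensor _) e2).trans ?_
  refine (hr _).trans ?_
  rw [Coalgebra.lTensor_counit_comul]
  exact (lTensor_rid_distribBaseChange_mk_one k K (η d)).symm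

variable {C : Type*} [AddCommGroup C] [Module k C] [Coalgebra k C]
  {G : D →ₗc[K] K ⊗[k] C} {g : L →ₗ[k] C}

/-- With universality of η, this and `counit_comp` say that the transpose of a coalgebra morphism
respects the coalgebra operations. -/
theorem comul_comp (hG : ∀ d, g.baseChange K (η d) = G d) (d : D) :
    (TensorProduct.map g g ∘ₗ comul).baseChange K (η d) =
      (comul ∘ₗ g).baseChange K (η d) := by
  apply (distribBaseChange k K C C).injective
  simp only [LinearMap.baseChange_comp, LinearMap.comp_apply]
  rw [distribBaseChange_baseChange_map, h.map_comul, hG, ← comul_baseChange,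
    ← CoalgHomClass.map_comp_comul_apply G, ← LinearMap.comp_apply, ← TensorProduct.map_comp]
  congr 2 <;> ext x <;> exact hG x

theorem counit_comp (hG : ∀ d, g.baseChange K (η d) = G d) (d : D) :
    (counit ∘ₗ g).baseChange K (η d) = (counit (R := k) (A := L)).baseChange K (η d) := by
  apply (AlgebraTensorModule.rid k K K).injective
  simp only [LinearMap.baseChange_comp, LinearMap.comp_apply]
  rw [hG, ← counit_baseChange, h.map_counit]
  exact CoalgHomClass.counit_comp_apply G d

end

/-- A compatible map into the base change of a coalgebra, as a coalgebra morphism. -/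
noncomputable def toCoalgHom [Coalgebra k L] {η : D →ₗ[K] K ⊗[k] L} (h : IsCompatible η) :
    D →ₗc[K] K ⊗[k] L where
  toLinearMap := η
  counit_comp := LinearMap.ext fun d => (counit_baseChange k K (η d)).trans (h.map_counit d)
  map_comp_comul := LinearMap.ext fun d =>
    ((comul_baseChange k K (η d)).trans (h.map_comul d)).symm

end IsCompatible

end Compatible

/-! ### Coalgebras: restriction of scalars and the first cofree statement -/

namespace FrobeniusSystem

open AlgebraTensorModule (distribBaseChange)

section RestrictCoalgebra

variable {k K : Type*} [Field k] [Field K] [Algebra k K] {ι : Type*} [Fintype ι]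
variable (F : FrobeniusSystem k K ι)
variable (D : Type*) [AddCommGroup D] [Module k D] [Module K D] [IsScalarTower k K D]
  [Coalgebra K D]

/-- The `k`-coalgebra operations on the restriction of scalars of a `K`-coalgebra. -/
@[reducible]
noncomputable def restrictCoalgebraStruct : CoalgebraStruct k D where
  comul := F.lift ((distribBaseChange k K D D).symm.toLinearMap ∘ₗ
    TensorProduct.map (F.unit D) (F.unit D) ∘ₗ Coalgebra.comul (R := K))
  counit := F.lift ((AlgebraTensorModule.rid k K K).symm.toLinearMap ∘ₗ
    Coalgebra.counit (R := K))

/-- The operations were defined as transposes of exactly the maps required here, so undoing the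
transposition gives both equations. -/
theorem isCompatible_unit :
    letI := F.restrictCoalgebraStruct D
    IsCompatible (F.unit D) := by
  let := F.restrictCoalgebraStruct D
  refine ⟨fun d => ?_, fun d => ?_⟩
  · refine (congrArg _ (F.baseChange_lift_unit _ d)).trans ?_
    simp
  · refine (congrArg _ (F.baseChange_lift_unit _ d)).trans ?_
    simp

/-- The `k`-coalgebra structure on the restriction of scalars of a `K`-coalgebra. -/
@[reducible]
noncomputable def restrictCoalgebra : Coalgebra k D :=
  letI := F.restrictCoalgebraStruct D
  { coassoc := F.hom_ext (F.isCompatible_unit D).coassoc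
    rTensor_counit_comp_comul := F.hom_ext (F.isCompatible_unit D).rTensor_counit
    lTensor_counit_comp_comul := F.hom_ext (F.isCompatible_unit D).lTensor_counit }

end RestrictCoalgebra

end FrobeniusSystem

theorem IsCofreeCoalgebra.baseChange {k : Type u} [Field k] (K : Type v) [Field K] [Algebra k K]
    [FiniteDimensional k K] {V C : Type (max u v w)} [AddCommGroup V] [Module k V]
    [AddCommGroup C] [Module k C] [Coalgebra k C] {π : C →ₗ[k] V} (hπ : IsCofreeCoalgebra k π) :
    IsCofreeCoalgebra K (C := K ⊗[k] C) (V := K ⊗[k] V) (π.baseChange K) := by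
  intro D _ _ _ f
  obtain ⟨F⟩ := FrobeniusSystem.nonempty k K
  let : Module k D := Module.compHom D (algebraMap k K)
  have : IsScalarTower k K D := IsScalarTower.of_compHom k K D
  let := F.restrictCoalgebra D
  have hη : IsCompatible (F.unit D) := F.isCompatible_unit D
  obtain ⟨g, hg, hu⟩ := hπ D (F.lift f)
  refine ⟨(Coalgebra.TensorProduct.map (.id K K) g).comp hη.toCoalgHom, ?_, fun G hG => ?_⟩
  · ext d
    rw [← F.baseChange_lift_unit f d, ← hg, LinearMap.baseChange_comp]
    rfl
  · have hG' (d : D) : (F.lift (G : D →ₗ[K] K ⊗[k] C)).baseChange K (F.unit D d) = G d :=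
      F.baseChange_lift_unit _ d
    let g' : D →ₗc[k] C :=
      { F.lift (G : D →ₗ[K] K ⊗[k] C) with
        counit_comp := F.hom_ext (hη.counit_comp hG')
        map_comp_comul := F.hom_ext (hη.comul_comp hG') }
    -- Uniqueness: the transpose of `G` is a coalgebra morphism, and its composite with π is the
    -- transpose of `f`.
    have : g' = g := hu g' <| F.hom_ext fun d => by
      rw [F.baseChange_lift_unit, ← hG, LinearMap.baseChange_comp]
      exact congrArg (π.baseChange K) (hG' d)
    ext d
    rw [← this]
    exact (hG' d).symm

/-! ### Algebras: the left adjoint of base change -/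

namespace FrobeniusSystem

section RestrictAlgebra

variable {k K : Type*} [Field k] [Field K] [Algebra k K] {ι : Type*} [Fintype ι]
variable (F : FrobeniusSystem k K ι)
variable (D : Type*) [Ring D] [Algebra K D] [Module k D] [IsScalarTower k K D]

/-- The relations on the tensor algebra of `D` which make the unit `D → K ⊗ T(D)` multiplicative. -/
inductive Rel : TensorAlgebra k D → TensorAlgebra k D → Prop
  -- Multiplicativity is an equation in K ⊗ T(D); it is imposed through all of its slices, which
  -- live in T(D).
  | mul (φ : K →ₗ[k] k) (a b : D) :
    Rel (sliceLeft _ φ ((TensorAlgebra.ι k).baseChange K (F.unit D (a * b))))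
      (sliceLeft _ φ ((TensorAlgebra.ι k).baseChange K (F.unit D a) *
        (TensorAlgebra.ι k).baseChange K (F.unit D b)))
  | one (φ : K →ₗ[k] k) :
    Rel (sliceLeft _ φ ((TensorAlgebra.ι k).baseChange K (F.unit D 1))) (sliceLeft _ φ 1)

/-- The value at the `K`-algebra `D` of the left adjoint of base change of algebras. -/
def RestrictAlgebra : Type _ := RingQuot (F.Rel D)

namespace RestrictAlgebra

noncomputable instance : Ring (F.RestrictAlgebra D) := inferInstanceAs (Ring (RingQuot (F.Rel D)))

noncomputable instance : Algebra k (F.RestrictAlgebra D) :=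
  inferInstanceAs (Algebra k (RingQuot (F.Rel D)))

/-- The quotient map from the tensor algebra. -/
noncomputable def mk : TensorAlgebra k D →ₐ[k] F.RestrictAlgebra D :=
  RingQuot.mkAlgHom k (F.Rel D)

/-- The linear map of `D` onto the generators. -/
noncomputable def of : D →ₗ[k] F.RestrictAlgebra D :=
  (mk F D).toLinearMap ∘ₗ TensorAlgebra.ι k

variable {D}
variable {A B : Type*} [Ring A] [Algebra k A] [Ring B] [Algebra k B]

theorem baseChange_mul (g : A →ₐ[k] B) (s t : K ⊗[k] A) :
    g.toLinearMap.baseChange K (s * t) =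
      g.toLinearMap.baseChange K s * g.toLinearMap.baseChange K t :=
  map_mul (Algebra.TensorProduct.map (.id K K) g) s t

theorem baseChange_one (g : A →ₐ[k] B) : g.toLinearMap.baseChange K (1 : K ⊗[k] A) = 1 :=
  map_one (Algebra.TensorProduct.map (.id K K) g)

variable (D) in
/-- The universal algebra morphism from `D` to a base change. -/
noncomputable def unit : D →ₐ[K] K ⊗[k] F.RestrictAlgebra D :=
  .ofLinearMap ((of F D).baseChange K ∘ₗ F.unit D)
    (F.eq_of_sliceLeft_eq fun φ => by
      have := RingQuot.mkAlgHom_rel k (Rel.one (F := F) (D := D) φ)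
      change mk F D _ = mk F D _ at this
      rw [← AlgHom.toLinearMap_apply, ← AlgHom.toLinearMap_apply, ← sliceLeft_baseChange,
        ← sliceLeft_baseChange, baseChange_one] at this
      rwa [of, LinearMap.baseChange_comp])
    (fun a b => F.eq_of_sliceLeft_eq fun φ => by
      have := RingQuot.mkAlgHom_rel k (Rel.mul (F := F) φ a b)
      change mk F D _ = mk F D _ at this
      rw [← AlgHom.toLinearMap_apply, ← AlgHom.toLinearMap_apply, ← sliceLeft_baseChange,
        ← sliceLeft_baseChange, baseChange_mul] at this
      rwa [of, LinearMap.baseChange_comp])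

theorem unit_apply (d : D) : unit F D d = (of F D).baseChange K (F.unit D d) := rfl

/-- The `k`-algebra morphism corresponding to a `K`-algebra morphism into a base change. -/
noncomputable def lift (f : D →ₐ[K] K ⊗[k] A) : F.RestrictAlgebra D →ₐ[k] A :=
  RingQuot.liftAlgHom k ⟨TensorAlgebra.lift k (F.lift f.toLinearMap), by
    have key (d : D) : (TensorAlgebra.lift k (F.lift f.toLinearMap)).toLinearMap.baseChange K
        ((TensorAlgebra.ι k).baseChange K (F.unit D d)) = f d := by
      rw [← LinearMap.comp_apply, ← LinearMap.baseChange_comp, TensorAlgebra.ι_comp_lift]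
      exact F.baseChange_lift_unit _ d
    intro x y h
    rw [← AlgHom.toLinearMap_apply, ← AlgHom.toLinearMap_apply]
    cases h with
    | mul φ a b =>
      rw [← sliceLeft_baseChange, ← sliceLeft_baseChange, baseChange_mul, key, key, key, map_mul]
    | one φ =>
      rw [← sliceLeft_baseChange, ← sliceLeft_baseChange, baseChange_one, key, map_one]⟩

theorem lift_comp_of (f : D →ₐ[K] K ⊗[k] A) :
    (lift F f).toLinearMap ∘ₗ of F D = F.lift f.toLinearMap := by
  ext d
  simp only [of, lift, LinearMap.comp_apply, AlgHom.toLinearMap_apply]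
  exact (RingQuot.liftAlgHom_mkAlgHom_apply ..).trans (TensorAlgebra.lift_ι_apply ..)

theorem baseChange_lift_unit (f : D →ₐ[K] K ⊗[k] A) (d : D) :
    (lift F f).toLinearMap.baseChange K (unit F D d) = f d := by
  rw [unit_apply, ← LinearMap.comp_apply, ← LinearMap.baseChange_comp, lift_comp_of]
  exact F.baseChange_lift_unit _ d

/-- For merely linear maps the unit detects equality on generators only. This version is kept for
the antipode identities, whose sides are not given as algebra morphisms. -/
theorem comp_of_ext {V : Type*} [AddCommGroup V] [Module k V] {g h : F.RestrictAlgebra D →ₗ[k] V}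
    (H : ∀ d, g.baseChange K (unit F D d) = h.baseChange K (unit F D d)) :
    g ∘ₗ of F D = h ∘ₗ of F D :=
  F.hom_ext fun d => by
    rw [LinearMap.baseChange_comp, LinearMap.baseChange_comp]
    exact H d

theorem algHom_ext {g h : F.RestrictAlgebra D →ₐ[k] A}
    (H : ∀ d, g.toLinearMap.baseChange K (unit F D d) = h.toLinearMap.baseChange K (unit F D d)) :
    g = h :=
  RingQuot.ringQuot_ext' k _ _ <| TensorAlgebra.hom_ext <| comp_of_ext F H

end RestrictAlgebra

end RestrictAlgebra

end FrobeniusSystem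

/-! ### Base change of multiplication, and convolution identities on products -/

section

variable (k K : Type*) [Field k] [Field K] [Algebra k K]
variable (A B : Type*) [Ring A] [Algebra k A] [Ring B] [Algebra k B]

open AlgebraTensorModule (distribBaseChange)

/-- The inverse of `distribBaseChange` for algebras, as an algebra morphism. -/
noncomputable def distribBaseChangeSymmAlgHom :
    (K ⊗[k] A) ⊗[K] (K ⊗[k] B) →ₐ[K] K ⊗[k] (A ⊗[k] B) :=
  Algebra.TensorProduct.lift
    (Algebra.TensorProduct.map (.id K K) Algebra.TensorProduct.includeLeft)
    (Algebra.TensorProduct.map (.id K K) Algebra.TensorProduct.includeRight)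
    fun s t => by
      induction s with
      | zero => simp
      | add x y hx hy => rw [map_add]; exact hx.add_left hy
      | tmul a x =>
        induction t with
        | zero => simp
        | add x y hx hy => rw [map_add]; exact hx.add_right hy
        | tmul b y => simp [commute_iff_eq, mul_comm a b]

theorem distribBaseChangeSymmAlgHom_apply (t : (K ⊗[k] A) ⊗[K] (K ⊗[k] B)) :
    distribBaseChangeSymmAlgHom k K A B t = (distribBaseChange k K A B).symm t := by
  have : (distribBaseChangeSymmAlgHom k K A B).toLinearMap =
      (distribBaseChange k K A B).symm.toLinearMap := by
    ext; simp [distribBaseChangeSymmAlgHom]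
  exact LinearMap.congr_fun this t

variable {A}

theorem baseChange_mul' (t : K ⊗[k] (A ⊗[k] A)) :
    (LinearMap.mul' k A).baseChange K t =
      LinearMap.mul' K (K ⊗[k] A) (distribBaseChange k K A A t) := by
  have : (LinearMap.mul' k A).baseChange K =
      LinearMap.mul' K (K ⊗[k] A) ∘ₗ (distribBaseChange k K A A).toLinearMap := by
    ext; simp
  exact LinearMap.congr_fun this t

theorem baseChange_linearMap (t : K ⊗[k] k) :
    (Algebra.linearMap k A).baseChange K t =
      algebraMap K (K ⊗[k] A) (AlgebraTensorModule.rid k K K t) := by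
  have : (Algebra.linearMap k A).baseChange K =
      Algebra.linearMap K (K ⊗[k] A) ∘ₗ (AlgebraTensorModule.rid k K K).toLinearMap := by
    ext; simp
  exact LinearMap.congr_fun this t

end

section

variable {R A : Type*} [CommRing R] [Ring A] [Algebra R A] {S : A →ₗ[R] A}
  (hS : ∀ x y, S (x * y) = S y * S x)
include hS

/-- In Sweedler notation S(s₁t₁)s₂t₂ = S(t₁)(S(s₁)s₂)t₂, and the inner factor is the scalar c. Hence
the antipode identity passes to products. In the mirror statement below, t is the inner factor. -/
theorem mul'_rTensor_mul {s : A ⊗[R] A} {c : R}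
    (hs : LinearMap.mul' R A (S.rTensor A s) = algebraMap R A c) (t : A ⊗[R] A) :
    LinearMap.mul' R A (S.rTensor A (s * t)) = c • LinearMap.mul' R A (S.rTensor A t) := by
  induction t with
  | zero => simp
  | add x y hx hy => simp only [mul_add, map_add, hx, hy, smul_add]
  | tmul x y =>
    have (s : A ⊗[R] A) : LinearMap.mul' R A (S.rTensor A (s * (x ⊗ₜ y))) =
        S x * LinearMap.mul' R A (S.rTensor A s) * y := by
      induction s with
      | zero => simp
      | add x y hx hy => simp only [mul_add, add_mul, map_add, hx, hy]
      | tmul a b => simp [hS, mul_assoc]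
    rw [this, hs, ← Algebra.commutes, mul_assoc, ← Algebra.smul_def]
    simp

theorem mul'_lTensor_mul {t : A ⊗[R] A} {c : R}
    (ht : LinearMap.mul' R A (S.lTensor A t) = algebraMap R A c) (s : A ⊗[R] A) :
    LinearMap.mul' R A (S.lTensor A (s * t)) = c • LinearMap.mul' R A (S.lTensor A s) := by
  induction s with
  | zero => simp
  | add x y hx hy => simp only [add_mul, map_add, hx, hy, smul_add]
  | tmul x y =>
    have (t : A ⊗[R] A) : LinearMap.mul' R A (S.lTensor A ((x ⊗ₜ y) * t)) =
        x * LinearMap.mul' R A (S.lTensor A t) * S y := by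
      induction t with
      | zero => simp
      | add x y hx hy => simp only [mul_add, add_mul, map_add, hx, hy]
      | tmul a b => simp [hS, mul_assoc]
    rw [this, ht, ← Algebra.commutes, mul_assoc, ← Algebra.smul_def]
    simp

end

/-! ### Bialgebra structure on the restricted algebra -/

namespace FrobeniusSystem.RestrictAlgebra

open AlgebraTensorModule (distribBaseChange)

variable {k K : Type*} [Field k] [Field K] [Algebra k K] {ι : Type*} [Fintype ι]
variable (F : FrobeniusSystem k K ι)

section Bialgebra

variable (D : Type*) [Ring D] [Bialgebra K D] [Module k D] [IsScalarTower k K D]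

/-- The comultiplication of the restriction of a bialgebra. -/
noncomputable def comulAlgHom :
    F.RestrictAlgebra D →ₐ[k] F.RestrictAlgebra D ⊗[k] F.RestrictAlgebra D :=
  lift F ((distribBaseChangeSymmAlgHom k K _ _).comp
    ((Algebra.TensorProduct.map (unit F D) (unit F D)).comp (Bialgebra.comulAlgHom K D)))

/-- The counit of the restriction of a bialgebra. -/
noncomputable def counitAlgHom : F.RestrictAlgebra D →ₐ[k] k :=
  lift F ((Algebra.TensorProduct.rid k K K).symm.toAlgHom.comp (Bialgebra.counitAlgHom K D))

/-- The `k`-coalgebra operations on the restriction of a bialgebra. -/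
@[reducible]
noncomputable def coalgebraStruct : CoalgebraStruct k (F.RestrictAlgebra D) where
  comul := (comulAlgHom F D).toLinearMap
  counit := (counitAlgHom F D).toLinearMap

/-- Stated for the bare operations, because the coalgebra axioms are deduced from it. -/
theorem isCompatible_unit' :
    letI := coalgebraStruct F D
    IsCompatible (unit F D).toLinearMap := by
  let := coalgebraStruct F D
  refine ⟨fun d => ?_, fun d => ?_⟩
  · refine (congrArg _ (baseChange_lift_unit F _ d)).trans ?_
    simp only [AlgHom.comp_apply, distribBaseChangeSymmAlgHom_apply, LinearEquiv.apply_symm_apply]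
    rfl
  · exact (congrArg _ (baseChange_lift_unit F _ d)).trans
      ((AlgebraTensorModule.rid k K K).apply_symm_apply _)

/-- Each axiom is an equality of algebra morphisms out of the restricted algebra, so it suffices to
check it along the unit, where compatibility applies. -/
noncomputable instance : Bialgebra k (F.RestrictAlgebra D) :=
  .ofAlgHom (comulAlgHom F D) (counitAlgHom F D)
    (algHom_ext F (letI := coalgebraStruct F D; (isCompatible_unit' F D).coassoc))
    (algHom_ext F (letI := coalgebraStruct F D; (isCompatible_unit' F D).rTensor_counit))
    (algHom_ext F (letI := coalgebraStruct F D; (isCompatible_unit' F D).lTensor_counit))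

theorem isCompatible_unit : IsCompatible (unit F D).toLinearMap := isCompatible_unit' F D

variable {D}
variable {B : Type*} [Ring B] [Bialgebra k B]

/-- The unit as a bialgebra morphism. -/
noncomputable def unitBialgHom : D →ₐc[K] K ⊗[k] F.RestrictAlgebra D :=
  { unit F D, (isCompatible_unit F D).toCoalgHom with }

theorem counitAlgHom_comp_lift (G : D →ₐc[K] K ⊗[k] B) :
    (Bialgebra.counitAlgHom k B).comp (lift F (G : D →ₐ[K] K ⊗[k] B)) =
      Bialgebra.counitAlgHom k (F.RestrictAlgebra D) := by
  refine algHom_ext F fun d => ?_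
  have e := (isCompatible_unit F D).counit_comp (G := (G : D →ₗc[K] K ⊗[k] B))
    (baseChange_lift_unit F (G : D →ₐ[K] K ⊗[k] B)) d
  exact e

theorem map_lift_comp_comulAlgHom (G : D →ₐc[K] K ⊗[k] B) :
    (Algebra.TensorProduct.map (lift F (G : D →ₐ[K] K ⊗[k] B))
      (lift F (G : D →ₐ[K] K ⊗[k] B))).comp (Bialgebra.comulAlgHom k (F.RestrictAlgebra D)) =
    (Bialgebra.comulAlgHom k B).comp (lift F (G : D →ₐ[K] K ⊗[k] B)) := by
  refine algHom_ext F fun d => ?_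
  have e := (isCompatible_unit F D).comul_comp (G := (G : D →ₗc[K] K ⊗[k] B))
    (baseChange_lift_unit F (G : D →ₐ[K] K ⊗[k] B)) d
  exact e

/-- The `k`-bialgebra morphism corresponding to a `K`-bialgebra morphism into a base change. -/
noncomputable def liftBialgHom (G : D →ₐc[K] K ⊗[k] B) : F.RestrictAlgebra D →ₐc[k] B :=
  .ofAlgHom (lift F (G : D →ₐ[K] K ⊗[k] B)) (counitAlgHom_comp_lift F G)
    (map_lift_comp_comulAlgHom F G)

theorem map_liftBialgHom_comp_unit (G : D →ₐc[K] K ⊗[k] B) :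
    (Bialgebra.TensorProduct.map (.id K K) (liftBialgHom F G)).comp (unitBialgHom F) = G := by
  ext d
  exact baseChange_lift_unit F (G : D →ₐ[K] K ⊗[k] B) d

end Bialgebra

end FrobeniusSystem.RestrictAlgebra

/-! ### Hopf structure on the restricted algebra -/

namespace FrobeniusSystem.RestrictAlgebra

open AlgebraTensorModule (distribBaseChange)
open Coalgebra (comul counit)

variable {k K : Type*} [Field k] [Field K] [Algebra k K] {ι : Type*} [Fintype ι]
variable (F : FrobeniusSystem k K ι)

@[elab_as_elim]
theorem induction {D : Type*} [Ring D] [Algebra K D] [Module k D] [IsScalarTower k K D]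
    {p : F.RestrictAlgebra D → Prop} (algebraMap : ∀ r, p (algebraMap k _ r))
    (of : ∀ d, p (of F D d)) (mul : ∀ x y, p x → p y → p (x * y))
    (add : ∀ x y, p x → p y → p (x + y)) (x : F.RestrictAlgebra D) : p x := by
  obtain ⟨t, rfl⟩ : ∃ t, mk F D t = x := RingQuot.mkAlgHom_surjective k (F.Rel D) x
  induction t using TensorAlgebra.induction with
  | algebraMap r => rw [AlgHom.commutes]; exact algebraMap r
  | ι d => exact of d
  | mul a b ha hb => rw [map_mul]; exact mul _ _ ha hb
  | add a b ha hb => rw [map_add]; exact add _ _ ha hb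

variable (D : Type*) [Ring D] [HopfAlgebra K D] [Module k D] [IsScalarTower k K D]

/-- The antipode of the restriction of a Hopf algebra, as an algebra morphism to the opposite. -/
noncomputable def antipodeAlgHomOp : F.RestrictAlgebra D →ₐ[k] (F.RestrictAlgebra D)ᵐᵒᵖ :=
  -- The antipode reverses products, so the universal property is applied to the opposite algebra,
  -- through (K ⊗ R)ᵒᵖ ≅ Kᵒᵖ ⊗ R ≅ K ⊗ Rᵒᵖ up to placing the opposites, with Kᵒᵖ ≅ K by
  -- commutativity.
  lift F ((Algebra.TensorProduct.congr (AlgEquiv.toOpposite K K).symm .refl).toAlgHom.comp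
    ((Algebra.TensorProduct.opAlgEquiv k K K (F.RestrictAlgebra D)).symm.toAlgHom.comp
      ((AlgHom.op (unit F D)).comp (HopfAlgebra.antipodeAlgHomOp K D))))

/-- The antipode of the restriction of a Hopf algebra. -/
noncomputable def antipode : F.RestrictAlgebra D →ₗ[k] F.RestrictAlgebra D :=
  (MulOpposite.opLinearEquiv k).symm.toLinearMap ∘ₗ (antipodeAlgHomOp F D).toLinearMap

theorem antipode_mul (x y : F.RestrictAlgebra D) :
    antipode F D (x * y) = antipode F D y * antipode F D x := by
  simp [antipode]

theorem antipode_algebraMap (r : k) : antipode F D (algebraMap k _ r) = algebraMap k _ r := by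
  simp [antipode]

theorem antipode_one : antipode F D 1 = 1 := by
  simp [antipode]

theorem baseChange_antipode_unit (d : D) :
    (antipode F D).baseChange K (unit F D d) = unit F D (HopfAlgebra.antipode K d) := by
  have key (t : K ⊗[k] F.RestrictAlgebra D) :
      ((MulOpposite.opLinearEquiv k).symm.toLinearMap.baseChange K
        (Algebra.TensorProduct.congr (AlgEquiv.toOpposite K K).symm .refl
          ((Algebra.TensorProduct.opAlgEquiv k K K (F.RestrictAlgebra D)).symm
            (MulOpposite.op t)))) = t := by
    induction t with
    | zero => simp
    | add x y hx hy => simp only [MulOpposite.op_add, map_add, hx, hy]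
    | tmul a x => simp
  rw [antipode, LinearMap.baseChange_comp, LinearMap.comp_apply, antipodeAlgHomOp,
    baseChange_lift_unit]
  exact key _

/-- The convolution S * id is not a priori multiplicative, so `algHom_ext` does not apply. The
identity is instead closed under products by `mul'_rTensor_mul`, and on generators it is carried
over from `D`, since the unit intertwines the antipodes. -/
theorem mul'_rTensor_antipode_comul (x : F.RestrictAlgebra D) :
    LinearMap.mul' k _ ((antipode F D).rTensor _ (comul x)) =
      algebraMap k (F.RestrictAlgebra D) (counit x) := by
  induction x using induction with
  | algebraMap r => simp [Algebra.TensorProduct.algebraMap_apply, antipode_algebraMap]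
  | add x y hx hy => simp only [map_add, hx, hy]
  | mul x y hx hy =>
    rw [Bialgebra.comul_mul, mul'_rTensor_mul (antipode_mul F D) hx, hy, Bialgebra.counit_mul,
      map_mul, Algebra.smul_def]
  | of d =>
    refine LinearMap.congr_fun (comp_of_ext F (g := LinearMap.mul' k _ ∘ₗ
      (antipode F D).rTensor _ ∘ₗ comul) (h := Algebra.linearMap k _ ∘ₗ counit) fun d => ?_) d
    have e := distribBaseChange_baseChange_map k K (antipode F D) (.id (M := F.RestrictAlgebra D))
      ((comul (R := k)).baseChange K (unit F D d))
    have hc := (isCompatible_unit F D).map_comul d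
    have hn := (isCompatible_unit F D).map_counit d
    rw [AlgHom.toLinearMap_apply] at hc hn
    rw [hc, LinearMap.baseChange_id] at e
    simp only [LinearMap.baseChange_comp, LinearMap.comp_apply]
    rw [baseChange_mul', baseChange_linearMap, hn, LinearMap.rTensor, e,
      ← AlgHom.commutes (unit F D), ← HopfAlgebra.mul_antipode_rTensor_comul_apply]
    generalize comul (R := K) d = z
    induction z with
    | zero => simp
    | add x y hx hy => simp only [map_add, hx, hy]
    | tmul x y => simp [baseChange_antipode_unit]

theorem mul'_lTensor_antipode_comul (x : F.RestrictAlgebra D) :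
    LinearMap.mul' k _ ((antipode F D).lTensor _ (comul x)) =
      algebraMap k (F.RestrictAlgebra D) (counit x) := by
  induction x using induction with
  | algebraMap r => simp [Algebra.TensorProduct.algebraMap_apply, antipode_one]
  | add x y hx hy => simp only [map_add, hx, hy]
  | mul x y hx hy =>
    -- Here the factor of `y` is the inner one, so the counits come out in reverse order; hence
    -- `mul_comm`.
    rw [Bialgebra.comul_mul, mul'_lTensor_mul (antipode_mul F D) hy, hx, Bialgebra.counit_mul,
      mul_comm, map_mul, Algebra.smul_def]
  | of d =>
    refine LinearMap.congr_fun (comp_of_ext F (g := LinearMap.mul' k _ ∘ₗ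
      (antipode F D).lTensor _ ∘ₗ comul) (h := Algebra.linearMap k _ ∘ₗ counit) fun d => ?_) d
    have e := distribBaseChange_baseChange_map k K (.id (M := F.RestrictAlgebra D)) (antipode F D)
      ((comul (R := k)).baseChange K (unit F D d))
    have hc := (isCompatible_unit F D).map_comul d
    have hn := (isCompatible_unit F D).map_counit d
    rw [AlgHom.toLinearMap_apply] at hc hn
    rw [hc, LinearMap.baseChange_id] at e
    simp only [LinearMap.baseChange_comp, LinearMap.comp_apply]
    rw [baseChange_mul', baseChange_linearMap, hn, LinearMap.lTensor, e,
      ← AlgHom.commutes (unit F D), ← HopfAlgebra.mul_antipode_lTensor_comul_apply]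
    generalize comul (R := K) d = z
    induction z with
    | zero => simp
    | add x y hx hy => simp only [map_add, hx, hy]
    | tmul x y => simp [baseChange_antipode_unit]

noncomputable instance : HopfAlgebra k (F.RestrictAlgebra D) where
  antipode := antipode F D
  mul_antipode_rTensor_comul := LinearMap.ext (mul'_rTensor_antipode_comul F D)
  mul_antipode_lTensor_comul := LinearMap.ext (mul'_lTensor_antipode_comul F D)

end FrobeniusSystem.RestrictAlgebra

/-! ### The cofree statements for bialgebras and Hopf algebras -/

open FrobeniusSystem (RestrictAlgebra)

section

variable {k : Type u} [Field k] (K : Type v) [Field K] [Algebra k K] [FiniteDimensional k K]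

/-- The universe contains those of k and K, so that K ⊗ B and the restricted algebra of `D` remain
in the range of the universal property. -/
theorem IsCofreeBialgebra.baseChange {A B : Type (max u v w)} [Ring A] [Algebra k A]
    [Ring B] [Bialgebra k B] {π : B →ₐ[k] A} (hπ : IsCofreeBialgebra k π) :
    IsCofreeBialgebra K (B := K ⊗[k] B) (A := K ⊗[k] A)
      (Algebra.TensorProduct.map (AlgHom.id K K) π) := by
  intro D _ _ f
  obtain ⟨F⟩ := FrobeniusSystem.nonempty k K
  let : Module k D := Module.compHom D (algebraMap k K)
  have : IsScalarTower k K D := IsScalarTower.of_compHom k K D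
  obtain ⟨g, hg, hu⟩ := hπ (F.RestrictAlgebra D) (RestrictAlgebra.lift F f)
  refine ⟨(Bialgebra.TensorProduct.map (.id K K) g).comp (RestrictAlgebra.unitBialgHom F), ?_,
    fun G hG => ?_⟩
  · ext d
    rw [← RestrictAlgebra.baseChange_lift_unit F f d, ← hg, AlgHom.comp_toLinearMap,
      LinearMap.baseChange_comp]
    rfl
  · have : RestrictAlgebra.liftBialgHom F G = g := hu _ <| RestrictAlgebra.algHom_ext F fun d => by
      rw [RestrictAlgebra.baseChange_lift_unit, ← hG, AlgHom.comp_toLinearMap,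
        LinearMap.baseChange_comp]
      exact congrArg (π.toLinearMap.baseChange K)
        (RestrictAlgebra.baseChange_lift_unit F (G : D →ₐ[K] K ⊗[k] B) d)
    rw [← this, RestrictAlgebra.map_liftBialgHom_comp_unit]

theorem IsCofreeHopfOnAlgebra.baseChange {A H : Type (max u v w)} [Ring A] [Algebra k A]
    [Ring H] [HopfAlgebra k H] {π : H →ₐ[k] A} (hπ : IsCofreeHopfOnAlgebra k π) :
    IsCofreeHopfOnAlgebra K (H := K ⊗[k] H) (A := K ⊗[k] A)
      (Algebra.TensorProduct.map (AlgHom.id K K) π) := by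
  intro D _ _ f
  obtain ⟨F⟩ := FrobeniusSystem.nonempty k K
  let : Module k D := Module.compHom D (algebraMap k K)
  have : IsScalarTower k K D := IsScalarTower.of_compHom k K D
  -- The restricted algebra of a Hopf algebra is again Hopf, so it is an admissible test object;
  -- otherwise the argument is that for bialgebras.
  obtain ⟨g, hg, hu⟩ := hπ (F.RestrictAlgebra D) (RestrictAlgebra.lift F f)
  refine ⟨(Bialgebra.TensorProduct.map (.id K K) g).comp (RestrictAlgebra.unitBialgHom F), ?_,
    fun G hG => ?_⟩
  · ext d
    rw [← RestrictAlgebra.baseChange_lift_unit F f d, ← hg, AlgHom.comp_toLinearMap,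
      LinearMap.baseChange_comp]
    rfl
  · have : RestrictAlgebra.liftBialgHom F G = g := hu _ <| RestrictAlgebra.algHom_ext F fun d => by
      rw [RestrictAlgebra.baseChange_lift_unit, ← hG, AlgHom.comp_toLinearMap,
        LinearMap.baseChange_comp]
      exact congrArg (π.toLinearMap.baseChange K)
        (RestrictAlgebra.baseChange_lift_unit F (G : D →ₐ[K] K ⊗[k] H) d)
    rw [← this, RestrictAlgebra.map_liftBialgHom_comp_unit]

theorem IsCofreeHopfOnBialgebra.baseChange {B H : Type (max u v w)} [Ring B] [Bialgebra k B]
    [Ring H] [HopfAlgebra k H] {π : H →ₐc[k] B} (hπ : IsCofreeHopfOnBialgebra k π) :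
    IsCofreeHopfOnBialgebra K (H := K ⊗[k] H) (B := K ⊗[k] B)
      (Bialgebra.TensorProduct.map (BialgHom.id K K) π) := by
  intro D _ _ f
  obtain ⟨F⟩ := FrobeniusSystem.nonempty k K
  let : Module k D := Module.compHom D (algebraMap k K)
  have : IsScalarTower k K D := IsScalarTower.of_compHom k K D
  obtain ⟨g, hg, hu⟩ := hπ (F.RestrictAlgebra D) (RestrictAlgebra.liftBialgHom F f)
  refine ⟨(Bialgebra.TensorProduct.map (.id K K) g).comp (RestrictAlgebra.unitBialgHom F), ?_,
    fun G hG => ?_⟩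
  · ext d
    rw [← RestrictAlgebra.map_liftBialgHom_comp_unit F f, ← hg]
    exact (LinearMap.congr_fun (LinearMap.baseChange_comp (A := K)
      (f := (g : F.RestrictAlgebra D →ₗ[k] H)) (π : H →ₗ[k] B)) (RestrictAlgebra.unit F D d)).symm
  -- The equation to be checked is between bialgebra morphisms; it is tested on underlying algebra
  -- morphisms, hence along the unit.
  · have : RestrictAlgebra.liftBialgHom F G = g := hu _ <| BialgHom.coe_toAlgHom_injective <|
      RestrictAlgebra.algHom_ext F fun d => by
        refine Eq.trans ?_ (RestrictAlgebra.baseChange_lift_unit F (f : D →ₐ[K] K ⊗[k] B) d).symm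
        rw [← hG]
        refine Eq.trans ?_ (congrArg ((π : H →ₐ[k] B).toLinearMap.baseChange K)
          (RestrictAlgebra.baseChange_lift_unit F (G : D →ₐ[K] K ⊗[k] H) d))
        rw [← LinearMap.comp_apply, ← LinearMap.baseChange_comp]
        rfl
    rw [← this, RestrictAlgebra.map_liftBialgHom_comp_unit]

end

theorem mainTheorem7 (k : Type u) [Field k] (K : Type v) [Field K] [Algebra k K]
    [FiniteDimensional k K] :
    (∀ (V C : Type (max u v w)) [AddCommGroup V] [Module k V]
        [AddCommGroup C] [Module k C] [Coalgebra k C] (π : C →ₗ[k] V),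
      IsCofreeCoalgebra k π →
        IsCofreeCoalgebra K (C := K ⊗[k] C) (V := K ⊗[k] V) (π.baseChange K)) ∧
    (∀ (A B : Type (max u v w)) [Ring A] [Algebra k A] [Ring B] [Bialgebra k B] (π : B →ₐ[k] A),
      IsCofreeBialgebra k π →
        IsCofreeBialgebra K (B := K ⊗[k] B) (A := K ⊗[k] A)
          (Algebra.TensorProduct.map (AlgHom.id K K) π)) ∧
    (∀ (B H : Type (max u v w)) [Ring B] [Bialgebra k B] [Ring H] [HopfAlgebra k H]
        (π : H →ₐc[k] B),
      IsCofreeHopfOnBialgebra k π →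
        IsCofreeHopfOnBialgebra K (H := K ⊗[k] H) (B := K ⊗[k] B)
          (Bialgebra.TensorProduct.map (BialgHom.id K K) π)) ∧
    (∀ (A H : Type (max u v w)) [Ring A] [Algebra k A] [Ring H] [HopfAlgebra k H] (π : H →ₐ[k] A),
      IsCofreeHopfOnAlgebra k π →
        IsCofreeHopfOnAlgebra K (H := K ⊗[k] H) (A := K ⊗[k] A)
          (Algebra.TensorProduct.map (AlgHom.id K K) π)) := by
  exact ⟨fun V C _ _ _ _ _ π => IsCofreeCoalgebra.baseChange.{u, v, w} K,
    fun A B _ _ _ _ π => IsCofreeBialgebra.baseChange.{u, v, w} K,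
    fun B H _ _ _ _ π => IsCofreeHopfOnBialgebra.baseChange.{u, v, w} K,
    fun A H _ _ _ _ π => IsCofreeHopfOnAlgebra.baseChange.{u, v, w} K⟩
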